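/- Let $X$ be a real reflexive Banach space and $Z$ a real Hausdorff topological vector space. Let $C\subseteq Z$ be a convex cone ($0\in C$, $tC\subseteq C$ for all $t\ge 0$, $C+C\subseteq C$) which is pointed ($C\cap(-C)=\{0\}$) and has nonempty interior $\operatorname{int}C$. Let $K\subseteq X$ be nonempty, convex and closed, and let $F:K\times K\times K\to Z$ satisfy the following conditions. (i) For every $y\in K$ at least one of the following holds, where all limits and neighbourhoods in $X$ are taken in the weak topology of $X$: - (a) for every $x\in K$ and every net $(x_\alpha)\subseteq K$ with $x_\alpha\to x$: if $F(x_\alpha,y,x_\alpha)\notin-\operatorname{int}C$ for all $\alpha$, then $F(x,y,x)\notin-\operatorname{int}C$; - (b) the map $x\mapsto F(x,y,x)$ is $C$-upper semicontinuous on $K$, i.e. for every $x\in K$ and every neighbourhood $V$ of $F(x,y,x)$ in $Z$ there is a neighbourhood $U$ of $x$ such that $F(u,y,u)\in V-C$ for all $u\in U\cap K$; - (c) for every $x\in K$ and every net $(x_\alpha)\subseteq K$ with $x_\alpha\to x$ there is a net $(z_\alpha)\subseteq Z$, indexed by the same directed set, converging to some $z\in Z$, such that $F(x_\alpha,y,x_\alpha)-z_\alpha\in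 -C$ for all $\alpha$ and $F(x,y,x)-z\in C$. (ii) For every $x\in K$ the map $y\mapsto F(x,y,x)$ is $C$-convex on $K$, i.e. $tF(x,y_1,x)+(1-t)F(x,y_2,x)-F(x,ty_1+(1-t)y_2,x)\in C$ for all $y_1,y_2\in K$ and $t\in[0,1]$. (iii) $F(x,x,x)\notin-\operatorname{int}C$ for every $x\in K$. (iv) There is $r>0$ such that $\{x\in K:\|x\|\le r\}\neq\emptyset$ and, for every $x\in K$ with $\|x\|\le r$, there is $y_0\in K$ with $\|y_0\|<r$ and $F(x,y_0,x)\in-C$. Then there exists $x_0\in K$ such that $F(x_0,y,x_0)\notin-\operatorname{int}C$ for all $y\in K$. -/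

import Mathlib

open Filter Topology
open scoped Pointwise

universe u v

/-- A normed space is reflexive if the canonical isometric embedding into its bidual is onto. -/
def IsReflexiveSpace (X : Type u) [NormedAddCommGroup X] [NormedSpace ℝ X] : Prop :=
  Function.Surjective (NormedSpace.inclusionInDoubleDual ℝ X)

/-- `f` is `C`-convex on the (convex) set `K`:
`t f(x) + (1 - t) f(y) - f(t x + (1 - t) y) ∈ C` for all `x, y ∈ K` and `t ∈ [0, 1]`. -/
def IsCConvexOn {X : Type u} [AddCommGroup X] [Module ℝ X] {Z : Type v} [AddCommGroup Z]
    [Module ℝ Z] (C : Set Z) (K : Set X) (f : X → Z) : Prop :=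
  ∀ x ∈ K, ∀ y ∈ K, ∀ t ∈ Set.Icc (0 : ℝ) 1,
    t • f x + (1 - t) • f y - f (t • x + (1 - t) • y) ∈ C

/-- `f : K → Z` is `C`-upper semicontinuous at every point `x` of `K`: for each neighbourhood `V`
of `f x` there is a neighbourhood `U` of `x` with `f u ∈ V - C` for all `u ∈ U ∩ K`. -/
def IsCUpperSemicontinuousOn {E : Type u} [TopologicalSpace E] {Z : Type v} [AddCommGroup Z]
    [TopologicalSpace Z] (C : Set Z) (K : Set E) (f : E → Z) : Prop :=
  ∀ x ∈ K, ∀ V ∈ 𝓝 (f x), ∃ U ∈ 𝓝 x, ∀ u ∈ U ∩ K, f u ∈ V - C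

/-- For every net in `K` converging to a point `x` of `K`: if `f ∉ -int C` along the net, then
`f x ∉ -int C`. A net is a family indexed by a nonempty directed preorder; index types in the
universe of the space suffice, since the neighbourhoods of a point live there. -/
def IsNetClosedCondition {E : Type u} [TopologicalSpace E] {Z : Type v} [AddCommGroup Z]
    [TopologicalSpace Z] (C : Set Z) (K : Set E) (f : E → Z) : Prop :=
  ∀ (ι : Type u) [Preorder ι] [IsDirectedOrder ι] [Nonempty ι] (a : ι → E) (x : E),
    (∀ i, a i ∈ K) → x ∈ K → Tendsto a atTop (𝓝 x) →
    (∀ i, f (a i) ∉ -interior C) → f x ∉ -interior C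

/-- For every `x ∈ K` and every net `(a i)` in `K` converging to `x` there is a net `(z i)` in `Z`,
over the same index set, converging to some `z`, with `f (a i) - z i ∈ -C` for all `i` and
`f x - z ∈ C`. -/
def IsNetMajorizedCondition {E : Type u} [TopologicalSpace E] {Z : Type v} [AddCommGroup Z]
    [TopologicalSpace Z] (C : Set Z) (K : Set E) (f : E → Z) : Prop :=
  ∀ x ∈ K, ∀ (ι : Type u) [Preorder ι] [IsDirectedOrder ι] [Nonempty ι] (a : ι → E),
    (∀ i, a i ∈ K) → Tendsto a atTop (𝓝 x) →
    ∃ (b : ι → Z) (z : Z), Tendsto b atTop (𝓝 z) ∧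
      (∀ i, f (a i) - b i ∈ -C) ∧ f x - z ∈ C

/-- One of the three conditions: (a) closedness along nets, (b) `C`-upper semicontinuity,
(c) the existence of convergent majorizing nets. -/
def SatisfiesABC {E : Type u} [TopologicalSpace E] {Z : Type v} [AddCommGroup Z]
    [TopologicalSpace Z] (C : Set Z) (K : Set E) (f : E → Z) : Prop :=
  IsNetClosedCondition C K f ∨ IsCUpperSemicontinuousOn C K f ∨ IsNetMajorizedCondition C K f

/-- One of (a), (b), (c), for a map on a subset of a normed space, with respect to the weak
topology. -/
def SatisfiesABCWeakly {X : Type u} [NormedAddCommGroup X] [NormedSpace ℝ X] {Z : Type v}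
    [AddCommGroup Z] [TopologicalSpace Z] (C : Set Z) (K : Set X) (f : X → Z) : Prop :=
  SatisfiesABC (E := WeakSpace ℝ X) C ((toWeakSpace ℝ X).symm ⁻¹' K)
    (fun w => f ((toWeakSpace ℝ X).symm w))

/-- `x₀` solves the weak vector equilibrium problem: `x₀ ∈ K` and
`F(x₀, y, x₀) ∉ -int C` for all `y ∈ K`. -/
def IsWeakEquilibrium {X : Type u} {Z : Type v} [AddCommGroup Z] [TopologicalSpace Z]
    (C : Set Z) (K : Set X) (F : X → X → X → Z) (x₀ : X) : Prop :=
  x₀ ∈ K ∧ ∀ y ∈ K, F x₀ y x₀ ∉ -interior C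

section Scarf

/-- If a finite set has exactly one element more than its image, then exactly two of its elements
can be erased without changing the image. -/
theorem Finset.exists_pair_forall_image_erase_iff {α β : Type*} [DecidableEq α] [DecidableEq β]
    (f : α → β) (s : Finset α) (t : Finset β) (hst : s.image f = t) (hcard : s.card = t.card + 1) :
    ∃ a ∈ s, ∃ b ∈ s, a ≠ b ∧ f a = f b ∧ ∀ x ∈ s, ((s.erase x).image f = t ↔ x = a ∨ x = b) := by
  obtain ⟨a, ha, b, hb, hab, hfab⟩ := Finset.exists_ne_map_eq_of_card_lt_of_maps_to
    (s := s) (t := t) (f := f) (by omega)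
    (fun x hx => by rw [← hst]; exact Finset.mem_image_of_mem f hx)
  refine ⟨a, ha, b, hb, hab, hfab, fun x hx => ⟨fun h => ?_, fun h => ?_⟩⟩
  · by_contra hne
    push Not at hne
    have hinj : Set.InjOn f (s.erase x : Finset α) := by
      rw [← Finset.card_image_iff, h, Finset.card_erase_of_mem hx]; omega
    exact hab (hinj (by simp [ha, hne.1.symm]) (by simp [hb, hne.2.symm]) hfab)
  · rw [← hst]
    apply Finset.Subset.antisymm (Finset.image_subset_image (Finset.erase_subset _ _))
    intro y hy
    obtain ⟨z, hz, rfl⟩ := Finset.mem_image.1 hy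
    by_cases hzx : z = x
    · rcases h with h | h
      · rw [hzx, h, hfab]
        exact Finset.mem_image_of_mem f (Finset.mem_erase.2 ⟨hab.symm, hb⟩)
      · rw [hzx, h, ← hfab]
        exact Finset.mem_image_of_mem f (Finset.mem_erase.2 ⟨hab, ha⟩)
    · exact Finset.mem_image_of_mem f (Finset.mem_erase.2 ⟨hzx, hz⟩)

/-- The supersets of `t` with one more element correspond to the elements outside `t`. -/
theorem Finset.card_filter_superset_card_succ {T : Type*} [Fintype T] [DecidableEq T]
    (P : Finset T → Prop) [DecidablePred P] (t : Finset T) {n : ℕ} (hn : n = t.card + 1) :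
    (Finset.univ.filter fun s : Finset T => (s.card = n ∧ P s) ∧ t ⊆ s).card =
      (Finset.univ.filter fun x => x ∉ t ∧ P (insert x t)).card := by
  symm
  refine Finset.card_bij (fun x _ => insert x t) ?_ ?_ ?_
  · intro x hx
    obtain ⟨hxt, hP⟩ := (Finset.mem_filter.1 hx).2
    exact Finset.mem_filter.2 ⟨Finset.mem_univ _,
      ⟨by rw [Finset.card_insert_of_notMem hxt, hn], hP⟩, Finset.subset_insert _ _⟩
  · intro x hx y hy h
    obtain ⟨hxt, -⟩ := (Finset.mem_filter.1 hx).2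
    have : x ∈ insert y t := h ▸ Finset.mem_insert_self x t
    exact (Finset.mem_insert.1 this).resolve_right hxt
  · intro s hs
    obtain ⟨⟨hcard, hP⟩, hts⟩ := (Finset.mem_filter.1 hs).2
    obtain ⟨x, hx⟩ := Finset.card_eq_one.1
      (show (s \ t).card = 1 by rw [Finset.card_sdiff_of_subset hts]; omega)
    have hxm : x ∈ s \ t := hx ▸ Finset.mem_singleton_self x
    have hins : insert x t = s := by
      rw [Finset.insert_eq, ← hx, Finset.sdiff_union_of_subset hts]
    exact ⟨x, Finset.mem_filter.2 ⟨Finset.mem_univ _, (Finset.mem_sdiff.1 hxm).2, hins ▸ hP⟩, hins⟩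

/-- A set `s` is dominant for a family of utilities if no point is strictly better than the
`i`-worst point of `s` for all `i` at once. -/
def IsDominant {I T L : Type*} [LE L] (u : I → T → L) (s : Finset T) : Prop :=
  ∀ y, ∃ i, ∀ x ∈ s, u i y ≤ u i x

theorem IsDominant.mono {I T L : Type*} [LE L] {u : I → T → L} {s t : Finset T}
    (h : IsDominant u s) (hts : t ⊆ s) : IsDominant u t := fun y =>
  (h y).imp fun _ hi x hx => hi x (hts hx)

variable {I T L : Type*} [Fintype I] [DecidableEq I] [Fintype T] [DecidableEq T] [LinearOrder L]

open Classical in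
/-- A dominant set of `card I - 1` elements that contains an element which is not a slack extends
to a dominant set of `card I` elements in exactly two ways. -/
theorem IsDominant.card_extensions_eq_two {u : I → T → L}
    (hu : ∀ i, Function.Injective (u i)) {e : I → T}
    (he_top : ∀ i j x, x ∉ Set.range e → i ≠ j → u i x < u i (e j))
    {t : Finset T} (ht : IsDominant u t) (hcard : Fintype.card I = t.card + 1)
    {t₀ : T} (ht₀ : t₀ ∈ t) (ht₀e : t₀ ∉ Set.range e) :
    (Finset.univ.filter fun x => x ∉ t ∧ IsDominant u (insert x t)).card = 2 := by
  have hmin : ∀ i, ∃ x ∈ t, ∀ y ∈ t, u i x ≤ u i y := fun i =>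
    Finset.exists_min_image t (u i) ⟨t₀, ht₀⟩
  choose m hmt hm using hmin
  have hsurj : Finset.univ.image m = t := by
    apply Finset.Subset.antisymm
    · intro x hx
      obtain ⟨i, -, rfl⟩ := Finset.mem_image.1 hx
      exact hmt i
    · intro x hx
      obtain ⟨i, hi⟩ := ht x
      refine Finset.mem_image.2 ⟨i, Finset.mem_univ _, ?_⟩
      exact hu i (le_antisymm (hm i x hx) (hi _ (hmt i)))
  obtain ⟨a, -, b, -, hab, hmab, hpair⟩ :=
    Finset.exists_pair_forall_image_erase_iff m Finset.univ t hsurj (by simpa using hcard)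
  have hne : ∀ k, (Finset.univ.filter fun y => ∀ l, l ≠ k → u l (m l) < u l y).Nonempty := by
    intro k
    refine ⟨e k, Finset.mem_filter.2 ⟨Finset.mem_univ _, fun l hl => ?_⟩⟩
    exact (hm l t₀ ht₀).trans_lt (he_top l k t₀ ht₀e hl)
  choose w hw hwmax using fun k => Finset.exists_max_image _ (u k) (hne k)
  simp only [Finset.mem_filter, Finset.mem_univ, true_and] at hw hwmax
  have hwne : w a ≠ w b := by
    intro h
    obtain ⟨l, hl⟩ := ht (w a)
    have h1 := hl _ (hmt l)
    by_cases hla : l = a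
    · have := hw b l (by rw [hla]; exact hab)
      rw [← h] at this
      exact absurd h1 (not_le.2 this)
    · exact absurd h1 (not_le.2 (hw a l hla))
  suffices h : (Finset.univ.filter fun x => x ∉ t ∧ IsDominant u (insert x t)) = {w a, w b} by
    rw [h, Finset.card_pair hwne]
  have hadd : ∀ k, (k = a ∨ k = b) → w k ∉ t ∧ IsDominant u (insert (w k) t) := by
    intro k hk
    have hk' := (hpair k (Finset.mem_univ _)).2 hk
    refine ⟨fun hwt => ?_, fun y => ?_⟩
    · rw [← hk'] at hwt
      obtain ⟨l, hl, hlw⟩ := Finset.mem_image.1 hwt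
      have := hw k l (Finset.ne_of_mem_erase hl)
      rw [hlw] at this
      exact lt_irrefl _ this
    · by_cases hy : ∀ l, l ≠ k → u l (m l) < u l y
      · refine ⟨k, fun x hx => ?_⟩
        rcases Finset.mem_insert.1 hx with rfl | hx
        · exact hwmax k y hy
        · obtain ⟨l, hl⟩ := ht y
          by_cases hlk : l = k
          · rw [← hlk]; exact hl x hx
          · exact absurd (hl _ (hmt l)) (not_le.2 (hy l hlk))
      · push Not at hy
        obtain ⟨l, hlk, hl⟩ := hy
        refine ⟨l, fun x hx => ?_⟩
        rcases Finset.mem_insert.1 hx with rfl | hx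
        · exact hl.trans (hw k l hlk).le
        · exact hl.trans (hm l x hx)
  ext x
  simp only [Finset.mem_filter, Finset.mem_univ, true_and, Finset.mem_insert,
    Finset.mem_singleton]
  constructor
  · rintro ⟨hxt, hdom⟩
    obtain ⟨k, hk⟩ := hdom x
    have hrep : ∀ z ∈ t, ∃ l, l ≠ k ∧ m l = z ∧ u l z ≤ u l x := by
      intro z hz
      obtain ⟨l, hl⟩ := hdom z
      refine ⟨l, ?_, ?_, hl x (Finset.mem_insert_self _ _)⟩
      · rintro rfl
        have := hu l (le_antisymm (hk z (Finset.mem_insert_of_mem hz))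
          (hl x (Finset.mem_insert_self _ _)))
        exact hxt (this ▸ hz)
      · exact hu l (le_antisymm (hm l z hz) (hl _ (Finset.mem_insert_of_mem (hmt l))))
    have himg : (Finset.univ.erase k).image m = t := by
      apply Finset.Subset.antisymm
      · exact (Finset.image_subset_image (Finset.subset_univ _)).trans hsurj.subset
      · intro z hz
        obtain ⟨l, hlk, hlz, -⟩ := hrep z hz
        exact Finset.mem_image.2 ⟨l, Finset.mem_erase.2 ⟨hlk, Finset.mem_univ _⟩, hlz⟩
    have hinj : Set.InjOn m (Finset.univ.erase k : Finset I) := by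
      rw [← Finset.card_image_iff, himg, Finset.card_erase_of_mem (Finset.mem_univ _),
        Finset.card_univ]
      omega
    have hxM : ∀ l, l ≠ k → u l (m l) < u l x := by
      intro l hl
      obtain ⟨l', hl'k, hl'm, hl'x⟩ := hrep (m l) (hmt l)
      have : l' = l := hinj (by simp [hl'k]) (by simp [hl]) hl'm
      subst this
      refine lt_of_le_of_ne hl'x fun h => hxt ?_
      rw [← hu _ h]; exact hmt _
    have hmax : ∀ y, (∀ l, l ≠ k → u l (m l) < u l y) → u k y ≤ u k x := by
      intro y hy
      obtain ⟨l, hl⟩ := hdom y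
      by_cases hlk : l = k
      · rw [← hlk]; exact hl x (Finset.mem_insert_self _ _)
      · exact absurd (hl _ (Finset.mem_insert_of_mem (hmt l))) (not_le.2 (hy l hlk))
    have hxw : x = w k := hu k (le_antisymm (hwmax k x hxM) (hmax _ (hw k)))
    rcases (hpair k (Finset.mem_univ _)).1 himg with rfl | rfl
    · exact Or.inl hxw
    · exact Or.inr hxw
  · rintro (rfl | rfl)
    · exact hadd a (Or.inl rfl)
    · exact hadd b (Or.inr rfl)

open Classical in
/-- The set of all slacks but one extends to a dominant set in exactly one way. -/
theorem card_extensions_slacks_eq_one {u : I → T → L}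
    (hu : ∀ i, Function.Injective (u i)) {e : I → T}
    (he_bot : ∀ i x, u i (e i) ≤ u i x)
    (he_top : ∀ i j x, x ∉ Set.range e → i ≠ j → u i x < u i (e j))
    (hT : ∃ x, x ∉ Set.range e) (k : I) :
    (Finset.univ.filter fun x => x ∉ (Finset.univ.erase k).image e ∧
      IsDominant u (insert x ((Finset.univ.erase k).image e))).card = 1 := by
  obtain ⟨w, hw, hwmax⟩ := Finset.exists_max_image
    (Finset.univ.filter fun x => x ∉ Set.range e) (u k)
    (by obtain ⟨x, hx⟩ := hT; exact ⟨x, by simpa using hx⟩)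
  replace hw : w ∉ Set.range e := (Finset.mem_filter.1 hw).2
  replace hwmax : ∀ y, y ∉ Set.range e → u k y ≤ u k w := fun y hy =>
    hwmax y (Finset.mem_filter.2 ⟨Finset.mem_univ _, hy⟩)
  have key : ∀ i y, y ∉ Set.range e → ¬ u i y ≤ u i (e i) := fun i y hy h =>
    hy ⟨i, hu i (le_antisymm (he_bot i y) h)⟩
  rw [Finset.card_eq_one]
  refine ⟨w, ?_⟩
  ext x
  simp only [Finset.mem_filter, Finset.mem_univ, true_and, Finset.mem_singleton]
  constructor
  · rintro ⟨hx, hdom⟩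
    have hmem : ∀ i, i ≠ k → e i ∈ insert x ((Finset.univ.erase k).image e) := fun i hi =>
      Finset.mem_insert_of_mem
        (Finset.mem_image_of_mem e (Finset.mem_erase.2 ⟨hi, Finset.mem_univ _⟩))
    obtain ⟨i, hi⟩ := hdom w
    have hik : i = k := by
      by_contra hik
      exact key i w hw (hi _ (hmem i hik))
    subst hik
    have h1 : u i w ≤ u i x := hi x (Finset.mem_insert_self _ _)
    have hxr : x ∉ Set.range e := by
      rintro ⟨j, rfl⟩
      by_cases hji : j = i
      · exact key i w hw (hji ▸ h1)
      · exact hx (Finset.mem_image_of_mem e (Finset.mem_erase.2 ⟨hji, Finset.mem_univ _⟩))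
    exact hu i (le_antisymm (hwmax x hxr) h1)
  · rintro rfl
    refine ⟨fun h => ?_, fun y => ?_⟩
    · obtain ⟨j, -, hj⟩ := Finset.mem_image.1 h
      exact hw ⟨j, hj⟩
    · by_cases hy : y ∈ Set.range e
      · obtain ⟨j, rfl⟩ := hy
        exact ⟨j, fun z _ => he_bot j z⟩
      · refine ⟨k, fun z hz => ?_⟩
        rcases Finset.mem_insert.1 hz with rfl | hz
        · exact hwmax y hy
        · obtain ⟨j, hj, rfl⟩ := Finset.mem_image.1 hz
          exact (he_top k j y hy (Finset.ne_of_mem_erase hj).symm).le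

/-- **Scarf's lemma** for colourings: there is a dominant set on which the colouring is a
bijection. -/
theorem exists_isDominant_image_eq_univ [Nonempty I] {u : I → T → L}
    (hu : ∀ i, Function.Injective (u i)) {e : I → T}
    (he_bot : ∀ i x, u i (e i) ≤ u i x)
    (he_top : ∀ i j x, x ∉ Set.range e → i ≠ j → u i x < u i (e j))
    (hT : ∃ x, x ∉ Set.range e) (c : T → I) (hc : ∀ i, c (e i) = i) :
    ∃ s : Finset T, s.card = Fintype.card I ∧ IsDominant u s ∧ s.image c = Finset.univ := by
  classical
  by_contra hcon
  push Not at hcon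
  obtain ⟨k⟩ := ‹Nonempty I›
  set J : Finset I := Finset.univ.erase k with hJ
  have hJcard : Fintype.card I = J.card + 1 := by
    rw [hJ, Finset.card_erase_of_mem (Finset.mem_univ _), Finset.card_univ]
    have := Fintype.card_pos_iff.2 ⟨k⟩
    omega
  have he_inj : Function.Injective e := fun i j h => by rw [← hc i, h, hc j]
  let rooms : Finset (Finset T) := Finset.univ.filter fun s =>
    s.card = Fintype.card I ∧ (IsDominant u s ∧ s.image c = J)
  let doors : Finset (Finset T) := Finset.univ.filter fun t =>
    t.card = J.card ∧ IsDominant u t ∧ t.image c = J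
  have hcount := Finset.sum_card_bipartiteAbove_eq_sum_card_bipartiteBelow
    (s := doors) (t := rooms) (fun t s : Finset T => t ⊆ s)
  have hroom : ∀ s ∈ rooms, (Finset.bipartiteBelow (fun t s : Finset T => t ⊆ s) doors s).card = 2 := by
    intro s hs
    obtain ⟨hscard, hsdom, hsc⟩ := (Finset.mem_filter.1 hs).2
    obtain ⟨a, ha, b, hb, hab, -, hpair⟩ :=
      Finset.exists_pair_forall_image_erase_iff c s J hsc (by omega)
    suffices h : Finset.bipartiteBelow (fun t s : Finset T => t ⊆ s) doors s =
        {s.erase a, s.erase b} by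
      rw [h, Finset.card_pair]
      intro h'
      have : b ∈ s.erase b := h' ▸ Finset.mem_erase.2 ⟨hab.symm, hb⟩
      exact (Finset.mem_erase.1 this).1 rfl
    have hdoor : ∀ x ∈ s, (x = a ∨ x = b) → s.erase x ∈ doors := fun x hx hxab =>
      Finset.mem_filter.2 ⟨Finset.mem_univ _, by rw [Finset.card_erase_of_mem hx]; omega,
        hsdom.mono (Finset.erase_subset _ _), (hpair x hx).2 hxab⟩
    ext t
    simp only [Finset.mem_bipartiteBelow, Finset.mem_insert, Finset.mem_singleton]
    constructor
    · rintro ⟨htd, hts⟩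
      obtain ⟨htcard, -, htc⟩ := (Finset.mem_filter.1 htd).2
      obtain ⟨x, hx⟩ := Finset.card_eq_one.1
        (show (s \ t).card = 1 by rw [Finset.card_sdiff_of_subset hts]; omega)
      have hxs : x ∈ s := (Finset.mem_sdiff.1 (hx ▸ Finset.mem_singleton_self x : x ∈ s \ t)).1
      have htx : t = s.erase x := by
        rw [Finset.erase_eq, ← hx, Finset.sdiff_sdiff_eq_self hts]
      rw [htx] at htc
      rcases (hpair x hxs).1 htc with rfl | rfl
      · exact Or.inl htx
      · exact Or.inr htx
    · rintro (rfl | rfl)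
      · exact ⟨hdoor a ha (Or.inl rfl), Finset.erase_subset _ _⟩
      · exact ⟨hdoor b hb (Or.inr rfl), Finset.erase_subset _ _⟩
  have hdoor : ∀ t ∈ doors, (Finset.bipartiteAbove (fun t s : Finset T => t ⊆ s) rooms t).card =
      (Finset.univ.filter fun x => x ∉ t ∧ IsDominant u (insert x t)).card := by
    intro t ht
    obtain ⟨htcard, -, htc⟩ := (Finset.mem_filter.1 ht).2
    have h1 := Finset.card_filter_superset_card_succ (fun s => IsDominant u s ∧ s.image c = J) t
      (n := Fintype.card I) (by omega)
    rw [Finset.bipartiteAbove, Finset.filter_filter, h1]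
    congr 1
    ext x
    simp only [Finset.mem_filter, Finset.mem_univ, true_and]
    refine ⟨fun h => ⟨h.1, h.2.1⟩, fun h => ⟨h.1, h.2, ?_⟩⟩
    have hne := hcon (insert x t) (by rw [Finset.card_insert_of_notMem h.1]; omega) h.2
    rw [Finset.image_insert, htc] at hne ⊢
    refine Finset.insert_eq_of_mem (Finset.mem_erase.2 ⟨fun hk => hne ?_, Finset.mem_univ _⟩)
    rw [hk, hJ, Finset.insert_erase (Finset.mem_univ _)]
  set t₁ : Finset T := J.image e with ht₁
  have hext₁ := card_extensions_slacks_eq_one hu he_bot he_top hT k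
  have ht₁d : t₁ ∈ doors := by
    obtain ⟨x, hx⟩ := Finset.card_pos.1 (hext₁.symm ▸ Nat.one_pos)
    refine Finset.mem_filter.2 ⟨Finset.mem_univ _, Finset.card_image_of_injective _ he_inj,
      (Finset.mem_filter.1 hx).2.2.mono (Finset.subset_insert _ _), ?_⟩
    rw [ht₁, Finset.image_image]
    simp [Function.comp_def, hc]
  have hother : ∀ t ∈ doors.erase t₁,
      (Finset.bipartiteAbove (fun t s : Finset T => t ⊆ s) rooms t).card = 2 := by
    intro t ht
    obtain ⟨hne, htd⟩ := Finset.mem_erase.1 ht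
    rw [hdoor t htd]
    obtain ⟨htcard, htdom, htc⟩ := (Finset.mem_filter.1 htd).2
    have : ∃ t₀ ∈ t, t₀ ∉ Set.range e := by
      by_contra h
      push Not at h
      refine hne (Finset.eq_of_subset_of_card_le ?_ ?_)
      · intro x hx
        obtain ⟨i, rfl⟩ := h x hx
        refine Finset.mem_image_of_mem e ?_
        rw [← htc, ← hc i]
        simpa [hc] using Finset.mem_image_of_mem c hx
      · rw [htcard]; exact Finset.card_image_le
    obtain ⟨t₀, h1, h2⟩ := this
    exact htdom.card_extensions_eq_two hu he_top (by omega) h1 h2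
  rw [Finset.sum_congr rfl hroom, ← Finset.add_sum_erase _ _ ht₁d, Finset.sum_congr rfl hother,
    hdoor t₁ ht₁d, hext₁, Finset.sum_const, Finset.sum_const] at hcount
  simp only [smul_eq_mul] at hcount
  omega

end Scarf
section KKM

variable {I : Type*} [Fintype I] [Nonempty I]

/-- Sperner-type statement on the grid of natural points with coordinate sum `N`: for every
labelling there is a set `D` of labels, represented by points that lie in a common box of side
`card I` whose lower corner `m` vanishes outside `D`. -/
theorem exists_labelled_grid_points (N : ℕ) (c : (I → ℕ) → I) :
    ∃ (D : Finset I) (x : I → I → ℕ) (m : I → ℕ), D.Nonempty ∧ (∀ k, k ∉ D → m k = 0) ∧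
      ∀ i ∈ D, ∑ k, x i k = N ∧ c (x i) = i ∧
        ∀ k, m k ≤ x i k ∧ x i k ≤ m k + Fintype.card I := by
  classical
  let V := {v : I → Fin (N + 1) // ∑ i, (v i : ℕ) = N}
  have mkV : ∀ f : I → ℕ, ∑ i, f i = N → ∃ v : V, ∀ i, (v.1 i : ℕ) = f i := fun f hf =>
    ⟨⟨fun i => ⟨f i, by
      have := Finset.single_le_sum (f := f) (fun _ _ => Nat.zero_le _) (Finset.mem_univ i)
      omega⟩, hf⟩, fun i => rfl⟩
  let w : I → V ⊕ I → ℕ := fun i => Sum.elim (fun v => (v.1 i : ℕ) + 1)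
    (fun j => if i = j then 0 else N + 2)
  let u : I → V ⊕ I → ℕ ×ₗ Fin (Fintype.card (V ⊕ I)) := fun i t =>
    toLex (w i t, Fintype.equivFin _ t)
  let e : I → V ⊕ I := Sum.inr
  let lab : V ⊕ I → I := Sum.elim (fun v => c fun i => (v.1 i : ℕ)) id
  have huw : ∀ i s t, u i s ≤ u i t → w i s ≤ w i t := fun i s t h => by
    rcases Prod.Lex.toLex_le_toLex.1 h with h | h
    · exact h.le
    · exact h.1.le
  have hu : ∀ i, Function.Injective (u i) := fun i s t h => by
    have := congrArg (fun z => (ofLex z).2) h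
    exact (Fintype.equivFin _).injective this
  have he_bot : ∀ i x, u i (e i) ≤ u i x := by
    intro i x
    by_cases hx : x = e i
    · rw [hx]
    · refine Prod.Lex.toLex_le_toLex.2 (Or.inl ?_)
      rcases x with v | j
      · simp [w, e]
      · have : i ≠ j := fun h => hx (by rw [h])
        simp [w, e, this]
  have he_top : ∀ i j x, x ∉ Set.range e → i ≠ j → u i x < u i (e j) := by
    intro i j x hx hij
    refine Prod.Lex.toLex_lt_toLex.2 (Or.inl ?_)
    rcases x with v | k
    · have := (v.1 i).2
      simp only [w, e, Sum.elim_inl, Sum.elim_inr, if_neg hij]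
      omega
    · exact absurd ⟨k, rfl⟩ hx
  obtain ⟨i₀⟩ := ‹Nonempty I›
  obtain ⟨v₀, -⟩ := mkV (Pi.single i₀ N) (by simp)
  have : Nonempty I := ⟨i₀⟩
  obtain ⟨s, -, hdom, hcol⟩ := exists_isDominant_image_eq_univ hu he_bot he_top
    ⟨Sum.inl v₀, by rintro ⟨j, hj⟩; cases hj⟩ lab (fun _ => rfl)
  let D : Finset I := Finset.univ.filter fun i => ∃ v : V, Sum.inl v ∈ s ∧ lab (Sum.inl v) = i
  have hdomD : ∀ y : V, ∃ i ∈ D, ∀ v : V, Sum.inl v ∈ s → (y.1 i : ℕ) ≤ v.1 i := by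
    intro y
    obtain ⟨i, hi⟩ := hdom (Sum.inl y)
    refine ⟨i, ?_, fun v hv => ?_⟩
    · have : i ∈ s.image lab := hcol ▸ Finset.mem_univ i
      obtain ⟨x, hx, hxi⟩ := Finset.mem_image.1 this
      rcases x with v | j
      · exact Finset.mem_filter.2 ⟨Finset.mem_univ _, v, hx, hxi⟩
      · have h1 := huw _ _ _ (hi _ hx)
        have h2 : j = i := hxi
        simp [w, h2] at h1
    · have := huw _ _ _ (hi _ hv)
      simpa [w] using this
  obtain ⟨i₁, hi₁, -⟩ := hdomD v₀
  let S : Finset V := Finset.univ.filter fun v => Sum.inl v ∈ s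
  have hS : ∀ v, v ∈ S ↔ Sum.inl v ∈ s := fun v => by simp [S]
  have hSne : S.Nonempty := by
    obtain ⟨v, hv, -⟩ := (Finset.mem_filter.1 hi₁).2
    exact ⟨v, (hS v).2 hv⟩
  choose p hpS hp using fun i => Finset.exists_min_image S (fun v => (v.1 i : ℕ)) hSne
  let m : I → ℕ := fun i => if i ∈ D then ((p i).1 i : ℕ) else 0
  have hmle : ∀ v ∈ S, ∀ k, m k ≤ v.1 k := by
    intro v hv k
    by_cases hk : k ∈ D
    · simpa [m, hk] using hp k v hv
    · simp [m, hk]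
  have hsum : N < ∑ i ∈ D, (m i + 1) := by
    by_contra hle
    push Not at hle
    obtain ⟨y, hy⟩ := mkV (fun i => (if i ∈ D then m i + 1 else 0) +
      (Pi.single i₁ (N - ∑ i ∈ D, (m i + 1)) : I → ℕ) i) (by
        rw [Finset.sum_add_distrib, Finset.sum_ite_mem, Finset.univ_inter]
        simp only [Finset.sum_pi_single', Finset.mem_univ, if_true]
        omega)
    obtain ⟨i, hiD, hi⟩ := hdomD y
    have h1 := hi (p i) ((hS _).1 (hpS i))
    rw [hy i] at h1
    simp only [m, hiD, if_true] at h1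
    omega
  have hub : ∀ v ∈ S, ∀ k, (v.1 k : ℕ) ≤ m k + Fintype.card I := by
    intro v hv k
    have h1 : ∑ i, (v.1 i : ℕ) = N := v.2
    have h2 : ∑ i ∈ D, (m i + 1) ≤ ∑ i, m i + Fintype.card I := by
      rw [Finset.sum_add_distrib]
      refine add_le_add (Finset.sum_le_univ_sum_of_nonneg fun _ => Nat.zero_le _) ?_
      simpa using Finset.card_le_univ D
    have h3 : ∑ i ∈ Finset.univ.erase k, m i ≤ ∑ i ∈ Finset.univ.erase k, (v.1 i : ℕ) :=
      Finset.sum_le_sum fun i _ => hmle v hv i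
    rw [← Finset.add_sum_erase _ _ (Finset.mem_univ k)] at h1 h2
    omega
  have hrep : ∀ i, ∃ v : V, i ∈ D → v ∈ S ∧ lab (Sum.inl v) = i := by
    intro i
    by_cases hi : i ∈ D
    · obtain ⟨v, hv, hvi⟩ := (Finset.mem_filter.1 hi).2
      exact ⟨v, fun _ => ⟨(hS v).2 hv, hvi⟩⟩
    · exact ⟨v₀, fun h => absurd h hi⟩
  choose x hx using hrep
  exact ⟨D, fun i k => ((x i).1 k : ℕ), m, ⟨i₁, hi₁⟩, fun k hk => by simp [m, hk], fun i hi =>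
    ⟨(x i).2, (hx i hi).2, fun k => ⟨hmle _ (hx i hi).1 k, hub _ (hx i hi).1 k⟩⟩⟩

/-- If finitely many closed sets indexed by the vertices cover the standard simplex, then some
point belongs to every set whose index is in the support of the point. -/
theorem exists_mem_stdSimplex_forall_pos_mem (B : I → Set (I → ℝ)) (hB : ∀ i, IsClosed (B i))
    (hcover : ∀ x ∈ stdSimplex ℝ I, ∃ i, x ∈ B i) :
    ∃ x ∈ stdSimplex ℝ I, ∀ i, 0 < x i → x ∈ B i := by
  classical
  have step : ∀ n : ℕ, ∃ (D : Finset I) (x : I → I → ℝ), D.Nonempty ∧ ∀ i ∈ D,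
      x i ∈ stdSimplex ℝ I ∧ x i ∈ B i ∧
      (∀ j ∈ D, ∀ k, |x i k - x j k| ≤ Fintype.card I / ((n : ℝ) + 1)) ∧
      ∀ k, k ∉ D → x i k ≤ Fintype.card I / ((n : ℝ) + 1) := by
    intro n
    have hn : (0 : ℝ) < (n : ℝ) + 1 := by positivity
    let q : (I → ℕ) → I → ℝ := fun v i => (v i : ℝ) / ((n : ℝ) + 1)
    have hlab : ∀ v : I → ℕ, ∃ i, q v ∈ stdSimplex ℝ I → q v ∈ B i := by
      intro v
      by_cases h : q v ∈ stdSimplex ℝ I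
      · exact (hcover _ h).imp fun _ hi _ => hi
      · exact ⟨Classical.arbitrary I, fun h' => absurd h' h⟩
    choose c hc using hlab
    obtain ⟨D, x, m, hD, hm, hx⟩ := exists_labelled_grid_points (n + 1) c
    have hq : ∀ i ∈ D, q (x i) ∈ stdSimplex ℝ I := fun i hi => by
      refine ⟨fun k => by positivity, ?_⟩
      have h1 : (∑ k, (x i k : ℝ)) = (n : ℝ) + 1 := by exact_mod_cast (hx i hi).1
      rw [← Finset.sum_div, h1, div_self hn.ne']
    refine ⟨D, fun i => q (x i), hD, fun i hi => ⟨hq i hi, ?_, fun j hj k => ?_, fun k hk => ?_⟩⟩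
    · have h1 := hc (x i) (hq i hi)
      rwa [(hx i hi).2.1] at h1
    · obtain ⟨h1, h2⟩ := (hx i hi).2.2 k
      obtain ⟨h3, h4⟩ := (hx j hj).2.2 k
      simp only [q]
      rw [← sub_div, abs_div, abs_of_pos hn]
      gcongr
      rw [abs_le]
      have h1' : (m k : ℝ) ≤ x i k := by exact_mod_cast h1
      have h2' : (x i k : ℝ) ≤ m k + Fintype.card I := by exact_mod_cast h2
      have h3' : (m k : ℝ) ≤ x j k := by exact_mod_cast h3
      have h4' : (x j k : ℝ) ≤ m k + Fintype.card I := by exact_mod_cast h4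
      constructor <;> linarith
    · have h2 := ((hx i hi).2.2 k).2
      rw [hm k hk, zero_add] at h2
      simp only [q]
      gcongr
  choose D x hD hx using step
  have hlim : Tendsto (fun n : ℕ => (Fintype.card I : ℝ) / ((n : ℝ) + 1))
      (hyperfilter ℕ : Filter ℕ) (𝓝 0) :=
    (tendsto_const_div_atTop_nhds_zero_nat (Fintype.card I : ℝ) |>.comp
      (tendsto_add_atTop_nat 1) |>.congr fun n => by simp).mono_left
        (Nat.hyperfilter_le_atTop)
  obtain ⟨D₀, hD₀⟩ : ∃ D₀, ∀ᶠ n in (hyperfilter ℕ : Filter ℕ), D n = D₀ := by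
    have h := ((hyperfilter ℕ).map D).eq_pure_of_finite
    obtain ⟨D₀, hD₀⟩ := h
    refine ⟨D₀, ?_⟩
    have : {D₀} ∈ (hyperfilter ℕ).map D := by rw [hD₀]; exact Ultrafilter.mem_pure.2 rfl
    exact this
  obtain ⟨i₀, hi₀⟩ : D₀.Nonempty := by
    obtain ⟨n, hn⟩ := hD₀.exists
    exact hn ▸ hD n
  obtain ⟨y, hyΔ, hy⟩ := (isCompact_stdSimplex ℝ I).ultrafilter_le_nhds
    ((hyperfilter ℕ).map fun n => x n i₀) (by
      rw [le_principal_iff]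
      exact hD₀.mono fun n hn => (hx n i₀ (hn ▸ hi₀)).1)
  replace hy : Tendsto (fun n => x n i₀) (hyperfilter ℕ : Filter ℕ) (𝓝 y) := hy
  refine ⟨y, hyΔ, fun i hi => ?_⟩
  have hiD : i ∈ D₀ := by
    by_contra hiD
    refine not_le.2 hi (le_of_tendsto_of_tendsto (tendsto_pi_nhds.1 hy i) hlim ?_)
    exact hD₀.mono fun n hn => (hx n i₀ (hn ▸ hi₀)).2.2.2 i (hn ▸ hiD)
  have hyi : Tendsto (fun n => x n i) (hyperfilter ℕ : Filter ℕ) (𝓝 y) := by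
    refine tendsto_pi_nhds.2 fun k => ?_
    have h1 : Tendsto (fun n => x n i k - x n i₀ k) (hyperfilter ℕ : Filter ℕ) (𝓝 0) :=
      squeeze_zero_norm' (hD₀.mono fun n hn =>
        (hx n i (hn ▸ hiD)).2.2.1 i₀ (hn ▸ hi₀) k) hlim
    simpa using h1.add (tendsto_pi_nhds.1 hy k)
  exact (hB i).mem_of_tendsto hyi (hD₀.mono fun n hn => (hx n i (hn ▸ hiD)).2.1)

/-- The **Knaster–Kuratowski–Mazurkiewicz lemma** on the standard simplex. -/
theorem exists_mem_stdSimplex_forall_mem (A : I → Set (I → ℝ)) (hA : ∀ i, IsClosed (A i))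
    (hcover : ∀ x ∈ stdSimplex ℝ I, ∃ i, 0 < x i ∧ x ∈ A i) :
    ∃ x ∈ stdSimplex ℝ I, ∀ i, x ∈ A i := by
  classical
  have hne : ∀ i, (A i).Nonempty := fun i => by
    obtain ⟨j, hj, hjA⟩ := hcover _ (single_mem_stdSimplex ℝ i)
    by_cases hij : j = i
    · exact ⟨_, hij ▸ hjA⟩
    · simp [hij] at hj
  let d : I → (I → ℝ) → ℝ := fun i x => Metric.infDist x (A i)
  have hd : ∀ i, Continuous (d i) := fun i => Metric.continuous_infDist_pt _
  obtain ⟨x, hx, hxB⟩ := exists_mem_stdSimplex_forall_pos_mem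
    (fun i => {x | x i * ∑ k, d k x ≤ d i x})
    (fun i => isClosed_le (by fun_prop) (hd i)) (fun x hx => by
      by_contra h
      push Not at h
      have h1 : ∑ i, d i x < ∑ i, x i * ∑ k, d k x :=
        Finset.sum_lt_sum_of_nonempty Finset.univ_nonempty fun i _ => not_le.1 (h i)
      rw [← Finset.sum_mul, hx.2, one_mul] at h1
      exact lt_irrefl _ h1)
  have hle : ∀ i, x i * ∑ k, d k x ≤ d i x := fun i => by
    rcases (hx.1 i).eq_or_lt with h | h
    · rw [← h, zero_mul]; exact Metric.infDist_nonneg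
    · exact hxB i h
  have heq : ∀ i, x i * ∑ k, d k x = d i x := fun i =>
    (Finset.sum_eq_sum_iff_of_le fun i _ => hle i).1
      (by rw [← Finset.sum_mul, hx.2, one_mul]) i (Finset.mem_univ i)
  obtain ⟨j, hj, hjA⟩ := hcover x hx
  have hsum : ∑ k, d k x = 0 := by
    have h1 := heq j
    rw [show d j x = 0 from Metric.infDist_zero_of_mem hjA] at h1
    exact (mul_eq_zero.1 h1).resolve_left hj.ne'
  refine ⟨x, hx, fun i => ?_⟩
  rw [(hA i).mem_iff_infDist_zero (hne i)]
  have h1 := heq i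
  rw [hsum, mul_zero] at h1
  exact h1.symm

end KKM

section Cone

theorem smul_mem_neg_interior {Z : Type*} [AddCommGroup Z] [Module ℝ Z] [TopologicalSpace Z]
    [ContinuousSMul ℝ Z] {C : PointedCone ℝ Z}
    {a : Z} (ha : a ∈ -interior (C : Set Z)) {t : ℝ} (ht : 0 < t) :
    t • a ∈ -interior (C : Set Z) := by
  have h : t • interior (C : Set Z) ⊆ interior (C : Set Z) := by
    refine interior_maximal ?_ (isOpen_interior.smul₀ ht.ne')
    rintro _ ⟨x, hx, rfl⟩
    exact PointedCone.smul_mem C ht.le (interior_subset hx)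
  rw [Set.mem_neg, ← smul_neg]
  exact h (Set.smul_mem_smul_set ha)

variable {Z : Type*} [AddCommGroup Z] [Module ℝ Z] [TopologicalSpace Z] [IsTopologicalAddGroup Z]
  {C : PointedCone ℝ Z}

theorem sub_mem_neg_interior {a c : Z} (ha : a ∈ -interior (C : Set Z)) (hc : c ∈ C) :
    a - c ∈ -interior (C : Set Z) := by
  have h : interior (C : Set Z) + {c} ⊆ interior (C : Set Z) := by
    refine interior_maximal ?_ isOpen_interior.add_right
    rintro _ ⟨x, hx, y, rfl, rfl⟩
    exact C.add_mem (interior_subset hx) hc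
  have := h (Set.add_mem_add (Set.mem_neg.1 ha) rfl)
  rw [Set.mem_neg, neg_sub', sub_neg_eq_add]
  exact this

variable [ContinuousSMul ℝ Z]

/-- A `C`-convex map sends a convex combination in which a point with value in `-int C` has
positive weight, and the other point has value in `-C`, into `-int C`. -/
theorem IsCConvexOn.mem_neg_interior {X : Type*} [AddCommGroup X] [Module ℝ X] {K : Set X}
    {f : X → Z} (hf : IsCConvexOn (C : Set Z) K f) {x y : X} (hx : x ∈ K) (hy : y ∈ K)
    (hfx : f x ∈ -interior (C : Set Z)) (hfy : f y ∈ -(C : Set Z)) {t : ℝ} (ht : 0 < t)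
    (ht1 : t ≤ 1) : f (t • x + (1 - t) • y) ∈ -interior (C : Set Z) := by
  have h1 := sub_mem_neg_interior (sub_mem_neg_interior (smul_mem_neg_interior hfx ht)
    (PointedCone.smul_mem C (sub_nonneg.2 ht1) hfy)) (hf x hx y hy t ⟨ht.le, ht1⟩)
  convert h1 using 1
  rw [smul_neg]
  abel

theorem IsCConvexOn.convex_setOf_mem_neg_interior {X : Type*} [AddCommGroup X] [Module ℝ X]
    {K : Set X} (hK : Convex ℝ K) {f : X → Z} (hf : IsCConvexOn (C : Set Z) K f) :
    Convex ℝ {x | x ∈ K ∧ f x ∈ -interior (C : Set Z)} := by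
  rintro x ⟨hx, hfx⟩ y ⟨hy, hfy⟩ a b ha hb hab
  refine ⟨hK hx hy ha hb hab, ?_⟩
  obtain rfl : b = 1 - a := by linarith
  rcases ha.eq_or_lt with rfl | ha
  · simpa using hfy
  · exact hf.mem_neg_interior hx hy hfx
      (Set.neg_subset_neg.2 interior_subset hfy) ha (by linarith)

end Cone

/-- A point of the closure is the limit of a net indexed by the neighbourhoods of the point. -/
theorem exists_net_tendsto_of_mem_closure {E : Type u} [TopologicalSpace E] {S : Set E} {x : E}
    (hx : x ∈ closure S) :
    ∃ (ι : Type u) (_ : Preorder ι) (_ : IsDirectedOrder ι) (_ : Nonempty ι) (a : ι → E),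
      (∀ i, a i ∈ S) ∧ Tendsto a atTop (𝓝 x) := by
  have h : ∀ U : {U : Set E // U ∈ 𝓝 x}ᵒᵈ, ∃ y, y ∈ (OrderDual.ofDual U).1 ∧ y ∈ S := fun U =>
    mem_closure_iff_nhds.1 hx _ (OrderDual.ofDual U).2
  choose a haU haS using h
  have hdir : IsDirectedOrder {U : Set E // U ∈ 𝓝 x}ᵒᵈ := ⟨fun U V =>
    ⟨OrderDual.toDual ⟨(OrderDual.ofDual U).1 ∩ (OrderDual.ofDual V).1,
      inter_mem (OrderDual.ofDual U).2 (OrderDual.ofDual V).2⟩,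
      Set.inter_subset_left, Set.inter_subset_right⟩⟩
  refine ⟨{U : Set E // U ∈ 𝓝 x}ᵒᵈ, inferInstance, hdir,
    ⟨OrderDual.toDual ⟨Set.univ, univ_mem⟩⟩, a, haS, fun V hV => ?_⟩
  refine mem_map.2 <| mem_of_superset (mem_atTop (OrderDual.toDual (⟨V, hV⟩ : {U : Set E // U ∈ 𝓝 x})))
    fun U hU => ?_
  exact (show (OrderDual.ofDual U).1 ⊆ V from hU) (haU U)

/-- Under any of the conditions (a), (b), (c) the points where `f` avoids `-int C` form a closed
set. -/
theorem SatisfiesABC.isClosed {E : Type u} [TopologicalSpace E] {Z : Type v} [AddCommGroup Z]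
    [Module ℝ Z] [TopologicalSpace Z] [IsTopologicalAddGroup Z] {C : PointedCone ℝ Z} {K : Set E}
    (hK : IsClosed K) {f : E → Z} (h : SatisfiesABC (C : Set Z) K f) :
    IsClosed {x | x ∈ K ∧ f x ∉ -interior (C : Set Z)} := by
  refine isClosed_of_closure_subset fun x hx => ?_
  have hxK : x ∈ K := closure_minimal (fun _ h => h.1) hK hx
  refine ⟨hxK, ?_⟩
  rcases h with h | h | h
  · obtain ⟨ι, _, _, _, a, haS, ha⟩ := exists_net_tendsto_of_mem_closure hx
    exact h ι a x (fun i => (haS i).1) hxK ha fun i => (haS i).2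
  · intro hfx
    obtain ⟨U, hU, hUf⟩ := h x hxK _ (isOpen_interior.neg.mem_nhds hfx)
    obtain ⟨u, huU, huK, hu⟩ := mem_closure_iff_nhds.1 hx U hU
    obtain ⟨v, hv, c, hc, hvc⟩ := hUf u ⟨huU, huK⟩
    exact hu (hvc ▸ sub_mem_neg_interior hv hc)
  · obtain ⟨ι, _, _, _, a, haS, ha⟩ := exists_net_tendsto_of_mem_closure hx
    obtain ⟨b, z, hb, hab, hz⟩ := h x hxK ι a (fun i => (haS i).1) ha
    intro hfx
    have hzC : z ∈ -interior (C : Set Z) := by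
      simpa using sub_mem_neg_interior hfx hz
    obtain ⟨i, hi⟩ := (hb.eventually_mem (isOpen_interior.neg.mem_nhds hzC)).exists
    refine (haS i).2 ?_
    simpa using sub_mem_neg_interior hi (hab i)

section Weak

variable {X : Type u} [NormedAddCommGroup X] [NormedSpace ℝ X]

/-- Closed balls around the origin of a reflexive space are weakly compact. -/
theorem IsReflexiveSpace.isCompact_closedBall (hX : IsReflexiveSpace X) (r : ℝ) :
    IsCompact ((toWeakSpace ℝ X).symm ⁻¹' Metric.closedBall 0 r) := by
  have h : (toWeakSpace ℝ X).symm ⁻¹' Metric.closedBall 0 r =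
      NormedSpace.inclusionInDoubleDualWeak ℝ X ⁻¹'
        (WeakDual.toStrongDual ⁻¹' Metric.closedBall 0 r) := by
    ext w
    have h1 : ‖NormedSpace.inclusionInDoubleDual ℝ X ((toWeakSpace ℝ X).symm w)‖ =
      ‖(toWeakSpace ℝ X).symm w‖ := (NormedSpace.inclusionInDoubleDualLi (𝕜 := ℝ)).norm_map _
    rw [Set.mem_preimage, Set.mem_preimage, Set.mem_preimage, mem_closedBall_zero_iff,
      ← h1]
    exact (mem_closedBall_zero_iff (E := StrongDual ℝ (StrongDual ℝ X))).symm
  rw [h]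
  refine (NormedSpace.isEmbedding_inclusionInDoubleDualWeak ℝ X).isCompact_preimage'
    (WeakDual.isCompact_closedBall 0 r) fun g _ => ?_
  obtain ⟨x, hx⟩ := hX (WeakDual.toStrongDual g)
  exact ⟨toWeakSpace ℝ X x, hx⟩

theorem Convex.isClosed_toWeakSpace_symm_preimage {K : Set X} (hK : Convex ℝ K)
    (hKc : IsClosed K) : IsClosed ((toWeakSpace ℝ X).symm ⁻¹' K) := by
  have h : (toWeakSpace ℝ X).symm ⁻¹' K = toWeakSpace ℝ X '' K :=
    ((toWeakSpace ℝ X).toEquiv.image_eq_preimage_symm K).symm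
  rw [h, ← hKc.closure_eq, hK.toWeakSpace_closure (𝕜 := ℝ)]
  exact isClosed_closure

/-- **Ky Fan's KKM lemma** in the weak topology: a family of weakly closed sets `G y`, `y ∈ B`, on a
weakly compact convex set `B` has a common point in `B`, if every convex combination of points `y`
lies in `G y` for one of those with positive weight. -/
theorem exists_mem_forall_mem_of_KKM {B : Set X} (hBne : B.Nonempty) (hB : Convex ℝ B)
    (hBc : IsCompact ((toWeakSpace ℝ X).symm ⁻¹' B)) (G : X → Set X)
    (hG : ∀ y ∈ B, IsClosed ((toWeakSpace ℝ X).symm ⁻¹' G y))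
    (hKKM : ∀ s : Finset B, ∀ w ∈ stdSimplex ℝ s,
      ∃ i : s, 0 < w i ∧ ∑ j : s, w j • (j.1 : X) ∈ G i.1) :
    ∃ x ∈ B, ∀ y ∈ B, x ∈ G y := by
  obtain ⟨w, hwB, hw⟩ := hBc.inter_iInter_nonempty
    (fun y : B => (toWeakSpace ℝ X).symm ⁻¹' G y) (fun y => hG y y.2) (by
      intro s
      rcases s.eq_empty_or_nonempty with rfl | hs
      · obtain ⟨x, hx⟩ := hBne
        exact ⟨toWeakSpace ℝ X x, by simpa using hx⟩
      have : Nonempty s := hs.to_subtype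
      let p : (s → ℝ) → X := fun w => ∑ j : s, w j • (j.1 : X)
      have hp : Continuous fun w => toWeakSpace ℝ X (p w) :=
        (toWeakSpaceCLM ℝ X).continuous.comp (by fun_prop)
      obtain ⟨w, hw, hwG⟩ := exists_mem_stdSimplex_forall_mem
        (fun i : s => p ⁻¹' G i.1) (fun i => (hG i.1 i.1.2).preimage hp) (hKKM s)
      refine ⟨toWeakSpace ℝ X (p w), ?_, ?_⟩
      · exact hB.sum_mem (fun i _ => hw.1 i) hw.2 fun i _ => i.1.2
      · exact Set.mem_iInter₂.2 fun i hi => hwG ⟨i, hi⟩)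
  exact ⟨(toWeakSpace ℝ X).symm w, hwB, fun y hy => Set.mem_iInter.1 hw ⟨y, hy⟩⟩

end Weak

theorem theorem4p2 {X : Type u} [NormedAddCommGroup X] [NormedSpace ℝ X] [CompleteSpace X]
    (hX : IsReflexiveSpace X)
    {Z : Type v} [AddCommGroup Z] [Module ℝ Z] [TopologicalSpace Z] [IsTopologicalAddGroup Z]
    [ContinuousSMul ℝ Z] [T2Space Z]
    (C : PointedCone ℝ Z) (hCpointed : (C : Set Z) ∩ -(C : Set Z) = {0})
    (hCint : (interior (C : Set Z)).Nonempty)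
    (K : Set X) (hKne : K.Nonempty) (hKconv : Convex ℝ K) (hKclosed : IsClosed K)
    (F : X → X → X → Z)
    (h_i : ∀ y ∈ K, SatisfiesABCWeakly (C : Set Z) K (fun x => F x y x))
    (h_ii : ∀ x ∈ K, IsCConvexOn (C : Set Z) K (fun y => F x y x))
    (h_iii : ∀ x ∈ K, F x x x ∉ -interior (C : Set Z))
    (h_iv : ∃ r : ℝ, 0 < r ∧ (∃ x ∈ K, ‖x‖ ≤ r) ∧ ∀ x ∈ K, ‖x‖ ≤ r →
      ∃ y₀ ∈ K, ‖y₀‖ < r ∧ F x y₀ x ∈ -(C : Set Z)) :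
    ∃ x₀, IsWeakEquilibrium (C : Set Z) K F x₀ := by
  obtain ⟨r, -, ⟨x₁, hx₁K, hx₁r⟩, hr⟩ := h_iv
  have hKw : IsClosed ((toWeakSpace ℝ X).symm ⁻¹' K) :=
    hKconv.isClosed_toWeakSpace_symm_preimage hKclosed
  have hBconv : Convex ℝ (K ∩ Metric.closedBall 0 r) := hKconv.inter (convex_closedBall 0 r)
  obtain ⟨x₀, hx₀, hx₀G⟩ := exists_mem_forall_mem_of_KKM (B := K ∩ Metric.closedBall 0 r)
    ⟨x₁, hx₁K, by simpa using hx₁r⟩ hBconv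
    (by
      rw [Set.preimage_inter]
      exact (hX.isCompact_closedBall r).inter_left hKw)
    (fun y => {x | x ∈ K ∧ F x y x ∉ -interior (C : Set Z)})
    (fun y hy => SatisfiesABC.isClosed hKw (h_i y hy.1))
    (by
      intro s w hw
      by_contra hcon
      push Not at hcon
      have hx : ∑ j : s, w j • (j.1 : X) ∈ K :=
        hKconv.sum_mem (fun i _ => hw.1 i) hw.2 fun i _ => i.1.2.1
      have hsupp : ∀ j ∈ (Finset.univ : Finset s), j ∉ Finset.univ.filter (fun j => 0 < w j) →
          w j = 0 := fun j _ hj =>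
        le_antisymm (not_lt.1 fun h => hj (Finset.mem_filter.2 ⟨Finset.mem_univ j, h⟩)) (hw.1 j)
      have hmem := ((h_ii _ hx).convex_setOf_mem_neg_interior hKconv).sum_mem
        (t := Finset.univ.filter fun j => 0 < w j) (w := w) (z := fun j => (j.1 : X))
        (fun i _ => hw.1 i)
        (by rw [Finset.sum_subset (Finset.filter_subset _ _) hsupp]; exact hw.2)
        (fun i hi => ⟨i.1.2.1, by
          by_contra h
          exact hcon i (Finset.mem_filter.1 hi).2 ⟨hx, h⟩⟩)
      rw [Finset.sum_subset (Finset.filter_subset _ _)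
        (fun j hj hj' => by rw [hsupp j hj hj', zero_smul])] at hmem
      exact h_iii _ hx hmem.2)
  refine ⟨x₀, hx₀.1, fun y hy hFy => ?_⟩
  obtain ⟨y₀, hy₀K, hy₀r, hFy₀⟩ := hr x₀ hx₀.1 (by simpa using hx₀.2)
  have hcont : Continuous fun t : ℝ => ‖t • y + (1 - t) • y₀‖ := by fun_prop
  have hev : ∀ᶠ t : ℝ in 𝓝[>] 0, ‖t • y + (1 - t) • y₀‖ < r :=
    (hcont.tendsto 0).mono_left nhdsWithin_le_nhds |>.eventually_lt_const (by simpa using hy₀r)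
  obtain ⟨t, htr, ht0, ht1⟩ := (hev.and (Ioc_mem_nhdsGT (zero_lt_one' ℝ))).exists
  refine (hx₀G (t • y + (1 - t) • y₀) ⟨hKconv hy hy₀K ht0.le (sub_nonneg.2 ht1) (by ring), ?_⟩).2
    ((h_ii x₀ hx₀.1).mem_neg_interior hy hy₀K hFy hFy₀ ht0 ht1)
  simpa using htr.le
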